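/- Let $K$ be a field. A power series $f\in K[[x_1,\ldots,x_n]]$ is called \emph{algebraic} if it is algebraic over the field $K(x_1,\ldots,x_n)$, that is, if there are polynomials $A_0,\ldots,A_m\in K[x_1,\ldots,x_n]$, not all zero, with $\sum_{i=0}^m A_i f^i=0$. The \emph{degree} of an algebraic power series $f$ is the least positive integer $m$ for which such a relation exists. The \emph{height} of a polynomial $P(Y)\in K[x_1,\ldots,x_n][Y]$ is the maximum of the total degrees (in $x_1,\ldots,x_n$) of its coefficients, and the \emph{height} of an algebraic power series $f$ is the minimum of the heights of the nonzero polynomials $P(Y)\in K[x_1,\ldots,x_n][Y]$ with $P(f)=0$. A power series with integer coefficients is called algebraic, and its degree and height are taken, with $K=\mathbb{Q}$. The \emph{diagonal} of $f=\sum a(i_1,\ldots,i_n)x_1^{i_1}\cdots x_n^{i_n}$ is the one-variable power series $\Delta(f)=\sum_{k\ge 0}a(k,\ldots,k)x^k$. For $g=\sum_k a(k)x^k\in\mathbb{Z}[[x]]$ and a prime $p$, put $g_{|p}=\sum_k (a(k)\bmod p)\,x^k\in\mathbb{F}_p[[x]]$. \textbf{Theorem.} There is an effective constant $A=A(n,d,h)\in\mathbb{N}$,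 depending only on $n$, $d$ and $h$ (that is, $(n,d,h)\mapsto A(n,d,h)$ is a computable function $\mathbb{N}^3\to\mathbb{N}$), with the following property. Let $f\in\mathbb{Z}[[x_1,\ldots,x_n]]$ be an algebraic power series of degree at most $d$ and height at most $h$. Then, for every prime number $p$, the power series $\Delta(f)_{|p}\in\mathbb{F}_p[[x]]$ is algebraic, of degree at most $p^{A}$ and height at most $A^2p^{A+1}$. -/

import Mathlib

namespace AlgSeries

/-- The height of a polynomial `P(Y)` with coefficients in `K[x]`: the maximum of the total degrees
of its coefficients. -/
noncomputable def polyHeight {σ K : Type*} [Field K] (P : Polynomial (MvPolynomial σ K)) : ℕ :=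
  P.support.sup fun i => (P.coeff i).totalDegree

/-- A power series over a field `K` is algebraic if some nonzero polynomial `P(Y)` with
coefficients in `K[x]` vanishes at it. -/
def IsAlgebraicSeries {σ K : Type*} [Field K] (f : MvPowerSeries σ K) : Prop :=
  ∃ P : Polynomial (MvPolynomial σ K), P ≠ 0 ∧ Polynomial.aeval f P = 0

/-- The degree of an algebraic power series `f`: the least positive integer `m` for which there is
a relation `∑ i ≤ m, A i * f ^ i = 0` with polynomials `A i`, not all zero. -/
noncomputable def degree {σ K : Type*} [Field K] (f : MvPowerSeries σ K) : ℕ :=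
  sInf {m | 0 < m ∧ ∃ P : Polynomial (MvPolynomial σ K),
    P ≠ 0 ∧ P.natDegree ≤ m ∧ Polynomial.aeval f P = 0}

/-- The (naive) height of an algebraic power series `f`: the least height of a nonzero polynomial
`P(Y)` with coefficients in `K[x]` that vanishes at `f`. -/
noncomputable def height {σ K : Type*} [Field K] (f : MvPowerSeries σ K) : ℕ :=
  sInf {H | ∃ P : Polynomial (MvPolynomial σ K),
    P ≠ 0 ∧ Polynomial.aeval f P = 0 ∧ polyHeight P = H}

/-- The diagonal `∑ k, a(k, …, k) t ^ k` of `f = ∑ a(i₁, …, iₙ) x₁ ^ i₁ ⋯ xₙ ^ iₙ`. -/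
noncomputable def diagonal {n : ℕ} {R : Type*} [CommRing R] (f : MvPowerSeries (Fin n) R) :
    PowerSeries R :=
  PowerSeries.mk fun k => MvPowerSeries.coeff (Finsupp.equivFunOnFinite.symm fun _ => k) f

end AlgSeries

/-! Let F be the reduction of f mod p, with P(F) = 0, deg P ≤ d and all exponents of P at most h. If
P'(G) ≠ 0 at a root G, then A(G)/P'(G) is the residue of A/P at Y = G. Cartier operators commute
with this residue, and they send A/P = A P^(p-1)/P^p to Λ(A P^(p-1))/P. Taking p-th sections brings
the degree and exponents of A P^(p-1) back to the bounds for A (`cartier_mem_residueSpace`). So the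
series A(G)/P'(G) form a Cartier-stable space of dimension at most d(h+1)^n, a bound free of p. If F
is not a simple root, some F^(p^e) is a simple root of another bounded polynomial, and sections
bring F itself back into the space.

The diagonal intertwines sections (`sect_diagonal`), so Δ(F) lies in a stable space V of dimension N
≤ d(h+1)^n. Since v = ∑ x^r (Λ_r v)^p, the powers v^(p^k), 0 ≤ k ≤ N, are all combinations of the
p^N-th powers of a basis of V, with coefficients of degree at most p^N. These N + 1 vectors of
length N satisfy a relation with coefficients of degree at most N p^N, which annihilates v.

The polynomial P comes from characteristic zero: an irreducible factor of an annihilator of least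
height has the least degree as well. Denominators and powers of p are then removed before reducing.
-/

namespace MvPowerSeries

/-! ### Cartier operators on multivariate power series -/

variable {σ R : Type*} [CommRing R]

/-- The Cartier operator (section operator): `∑ a(m) x ^ m ↦ ∑ a(p m + r) x ^ m`. -/
noncomputable def cartier (p : ℕ) (r : σ →₀ ℕ) : MvPowerSeries σ R →ₗ[R] MvPowerSeries σ R where
  toFun f := fun m => coeff (p • m + r) f
  map_add' _ _ := rfl
  map_smul' _ _ := rfl

@[simp]
theorem coeff_cartier (p : ℕ) (r m : σ →₀ ℕ) (f : MvPowerSeries σ R) :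
    coeff m (cartier p r f) = coeff (p • m + r) f := rfl

/-- Only exponents divisible by p occur in `expand p hp g`, and p a + b = p m + r forces b = p (m -
a) + r. -/
theorem cartier_expand_mul {p : ℕ} (hp : p ≠ 0) {r : σ →₀ ℕ} (hr : ∀ i, r i < p)
    (g f : MvPowerSeries σ R) :
    cartier p r (expand p hp g * f) = g * cartier p r f := by
  classical
  ext m
  rw [coeff_cartier, coeff_mul, coeff_mul]
  symm
  refine Finset.sum_of_injOn (fun x => (p • x.1, p • x.2 + r)) ?_ ?_ ?_ ?_
  · rintro ⟨a, b⟩ h ⟨a', b'⟩ h' hab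
    simp only [Prod.mk.injEq, add_left_inj] at hab
    simp only [Prod.mk.injEq]
    exact ⟨nsmul_right_injective hp hab.1, nsmul_right_injective hp hab.2⟩
  · rintro ⟨a, b⟩ h
    simp only [Finset.mem_coe, Finset.HasAntidiagonal.mem_antidiagonal] at h ⊢
    rw [← h, smul_add, add_assoc]
  · rintro ⟨a, b⟩ h h'
    simp only [Finset.HasAntidiagonal.mem_antidiagonal] at h
    by_cases hd : ∀ i, p ∣ a i
    · exfalso
      apply h'
      have hi : ∀ i, a i + b i = p * m i + r i := fun i => by
        simpa using DFunLike.congr_fun h i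
      -- Here r < p is essential: a multiple of p that is at most p m + r is at most p m.
      have hle : ∀ i, a i / p ≤ m i := fun i => by
        have h1 : a i ≤ p * m i + r i := by have := hi i; omega
        obtain ⟨c, hc⟩ := hd i
        rw [hc, Nat.mul_div_cancel_left _ (Nat.pos_of_ne_zero hp)]
        by_contra! hlt
        have : p * (m i + 1) ≤ p * c := Nat.mul_le_mul_left _ hlt
        have := hr i
        rw [mul_add] at *
        omega
      have ha : ∀ i, p * (a i / p) = a i := fun i => Nat.mul_div_cancel' (hd i)
      refine ⟨(a.mapRange (· / p) (Nat.zero_div p), m - a.mapRange (· / p) (Nat.zero_div p)),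
        ?_, ?_⟩
      · simp only [Finset.mem_coe, Finset.HasAntidiagonal.mem_antidiagonal]
        ext i
        simpa using Nat.add_sub_cancel' (hle i)
      · simp only [Prod.mk.injEq]
        constructor
        · ext i; simpa using ha i
        · ext i
          have h1 := hi i
          have h2 := ha i
          have h3 : p * (a i / p) ≤ p * m i := Nat.mul_le_mul_left _ (hle i)
          simp only [Finsupp.coe_add, Finsupp.coe_smul, Finsupp.coe_tsub, Pi.add_apply,
            Pi.smul_apply, Pi.sub_apply, Finsupp.mapRange_apply, smul_eq_mul, Nat.mul_sub]
          omega
    · push Not at hd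
      obtain ⟨i, hi⟩ := hd
      rw [coeff_expand_of_not_dvd p hp g hi, zero_mul]
  · rintro ⟨a, b⟩ h
    simp

theorem cartier_zero_expand {p : ℕ} (hp : p ≠ 0) (g : MvPowerSeries σ R) :
    cartier p 0 (expand p hp g) = g := by
  ext m
  simp

/-- Frobenius fixes the coefficients in `ZMod p`, so a p-th power only dilates exponents. -/
theorem expand_eq_pow (p : ℕ) [hp : Fact p.Prime] (g : MvPowerSeries σ (ZMod p)) :
    expand p hp.out.ne_zero g = g ^ p := by
  rw [← map_frobenius_expand p hp.out.ne_zero, ZMod.frobenius_zmod, map_id, RingHom.id_apply]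

theorem cartier_pow_mul {p : ℕ} [hp : Fact p.Prime] {r : σ →₀ ℕ} (hr : ∀ i, r i < p)
    (g f : MvPowerSeries σ (ZMod p)) :
    cartier p r (g ^ p * f) = g * cartier p r f := by
  rw [← expand_eq_pow, cartier_expand_mul _ hr]

/-! ### Polynomials with bounded degree and exponents -/

/-- The polynomials, seen as power series, all of whose exponents are at most `h`. -/
def boundedExponents (σ R : Type*) [CommRing R] (h : ℕ) : Submodule R (MvPowerSeries σ R) where
  carrier := {f | ∀ m, coeff m f ≠ 0 → ∀ i, m i ≤ h}
  zero_mem' m hm := by simp at hm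
  add_mem' {f g} hf hg m hm := by
    by_cases h0 : coeff m f = 0
    · exact hg m (by simpa [h0] using hm)
    · exact hf m h0
  smul_mem' c f hf m hm := hf m fun h0 => hm (by simp [h0])

theorem mul_mem_boundedExponents {a b : ℕ} {f g : MvPowerSeries σ R}
    (hf : f ∈ boundedExponents σ R a) (hg : g ∈ boundedExponents σ R b) :
    f * g ∈ boundedExponents σ R (a + b) := by
  classical
  intro m hm i
  rw [coeff_mul] at hm
  obtain ⟨⟨x, y⟩, hx, hne⟩ := Finset.exists_ne_zero_of_sum_ne_zero hm
  rw [← Finset.HasAntidiagonal.mem_antidiagonal.1 hx]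
  exact add_le_add (hf x (left_ne_zero_of_mul hne) i) (hg y (right_ne_zero_of_mul hne) i)

theorem cartier_mem_boundedExponents {p h : ℕ} (hp : 0 < p) {r : σ →₀ ℕ} {f : MvPowerSeries σ R}
    (hf : f ∈ boundedExponents σ R (p * h)) : cartier p r f ∈ boundedExponents σ R h := by
  intro m hm i
  have := hf _ hm i
  simp only [Finsupp.coe_add, Finsupp.coe_smul, Pi.add_apply, Pi.smul_apply, smul_eq_mul] at this
  exact Nat.le_of_mul_le_mul_left (by omega) hp

/-- The polynomials in `Y` of degree less than `d`, whose coefficients are polynomials with all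
exponents at most `h`. -/
def boundedPolynomials (σ R : Type*) [CommRing R] (d h : ℕ) :
    Submodule R (Polynomial (MvPowerSeries σ R)) where
  carrier := {A | (∀ j, d ≤ j → A.coeff j = 0) ∧ ∀ j, A.coeff j ∈ boundedExponents σ R h}
  zero_mem' := by simp
  add_mem' {A B} hA hB := by
    refine ⟨fun j hj => by simp [hA.1 j hj, hB.1 j hj], fun j => ?_⟩
    rw [Polynomial.coeff_add]
    exact add_mem (hA.2 j) (hB.2 j)
  smul_mem' c A hA := by
    refine ⟨fun j hj => by simp [hA.1 j hj], fun j => ?_⟩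
    rw [Polynomial.coeff_smul]
    exact Submodule.smul_mem _ _ (hA.2 j)

theorem mul_mem_boundedPolynomials {d e a b : ℕ} {A B : Polynomial (MvPowerSeries σ R)}
    (hA : A ∈ boundedPolynomials σ R d a) (hB : B ∈ boundedPolynomials σ R (e + 1) b) :
    A * B ∈ boundedPolynomials σ R (d + e) (a + b) := by
  refine ⟨fun j hj => ?_, fun j => ?_⟩
  · rw [Polynomial.coeff_mul]
    refine Finset.sum_eq_zero fun x hx => ?_
    rw [Finset.HasAntidiagonal.mem_antidiagonal] at hx
    by_cases h : d ≤ x.1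
    · rw [hA.1 _ h, zero_mul]
    · rw [hB.1 _ (by omega), mul_zero]
  · rw [Polynomial.coeff_mul]
    exact sum_mem fun x _ => mul_mem_boundedExponents (hA.2 _) (hB.2 _)

theorem mul_pow_mem_boundedPolynomials {d e a b : ℕ} {A B : Polynomial (MvPowerSeries σ R)}
    (hA : A ∈ boundedPolynomials σ R d a) (hB : B ∈ boundedPolynomials σ R (e + 1) b) (k : ℕ) :
    A * B ^ k ∈ boundedPolynomials σ R (d + k * e) (a + k * b) := by
  induction k with
  | zero => simpa using hA
  | succ k ih =>
    rw [pow_succ, ← mul_assoc, add_mul, add_mul, one_mul, one_mul, ← add_assoc, ← add_assoc]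
    exact mul_mem_boundedPolynomials ih hB

/-- The coefficients of a member of `boundedPolynomials` that may be nonzero. -/
noncomputable def boundedPolynomialsCoeff (σ R : Type*) [CommRing R] [Finite σ] (d h : ℕ) :
    boundedPolynomials σ R d h →ₗ[R] (Fin d × (σ → Fin (h + 1)) → R) where
  toFun A x := coeff (Finsupp.equivFunOnFinite.symm fun s => (x.2 s : ℕ)) (A.1.coeff x.1)
  map_add' A B := by ext; simp
  map_smul' c A := by ext; simp

theorem boundedPolynomialsCoeff_injective [Finite σ] (d h : ℕ) :
    Function.Injective (boundedPolynomialsCoeff σ R d h) := by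
  rw [injective_iff_map_eq_zero]
  rintro ⟨A, hA⟩ h0
  rw [Subtype.ext_iff]
  refine Polynomial.ext fun j => MvPowerSeries.ext fun m => ?_
  simp only [ZeroMemClass.coe_zero, Polynomial.coeff_zero, map_zero]
  by_contra hne
  have hj : j < d := by
    by_contra! hj
    simp [hA.1 j hj] at hne
  have hm := hA.2 j m hne
  apply hne
  have := congrFun h0 (⟨j, hj⟩, fun s => ⟨m s, Nat.lt_succ_of_le (hm s)⟩)
  have hms : Finsupp.equivFunOnFinite.symm (fun s => m s) = m := by ext; simp
  simpa [boundedPolynomialsCoeff, hms] using this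

theorem boundedPolynomials_finrank_le {K : Type*} [Field K] [Fintype σ] (d h : ℕ) :
    FiniteDimensional K (boundedPolynomials σ K d h) ∧
      Module.finrank K (boundedPolynomials σ K d h) ≤ d * (h + 1) ^ Fintype.card σ := by
  classical
  refine ⟨FiniteDimensional.of_injective _ (boundedPolynomialsCoeff_injective d h), ?_⟩
  refine (LinearMap.finrank_le_finrank_of_injective
    (boundedPolynomialsCoeff_injective d h)).trans ?_
  simp

end MvPowerSeries

/-! ### Cartier operators and residues -/

namespace Polynomial

open MvPowerSeries (cartier coeff_cartier)

variable {σ : Type*}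

/-- The Cartier operator on polynomials in `Y` over power series, with section `r` for the
power series variables and `p - 1` for `Y`. -/
noncomputable def cartierResidue {R : Type*} [CommRing R] (p : ℕ) (r : σ →₀ ℕ)
    (H : Polynomial (MvPowerSeries σ R)) : Polynomial (MvPowerSeries σ R) :=
  ∑ j ∈ Finset.range (H.natDegree + 1), monomial j (cartier p r (H.coeff (p * j + (p - 1))))

theorem coeff_cartierResidue {R : Type*} [CommRing R] {p : ℕ} (hp : 0 < p) (r : σ →₀ ℕ)
    (H : Polynomial (MvPowerSeries σ R)) (j : ℕ) :
    (cartierResidue p r H).coeff j = cartier p r (H.coeff (p * j + (p - 1))) := by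
  simp only [cartierResidue, finsetSum_coeff, coeff_monomial, Finset.sum_ite_eq',
    Finset.mem_range]
  split_ifs with h
  · rfl
  · rw [coeff_eq_zero_of_natDegree_lt, map_zero]
    have : j ≤ p * j := Nat.le_mul_of_pos_left j hp
    omega

/-- The Cartier operator commutes with taking the residue at `Y = F`. -/
theorem eval_cartierResidue {p : ℕ} [hp : Fact p.Prime] {r : σ →₀ ℕ} (hr : ∀ i, r i < p)
    (F : MvPowerSeries σ (ZMod p)) (H : Polynomial (MvPowerSeries σ (ZMod p))) :
    (cartierResidue p r (H * (X - C F) ^ (p - 1))).eval F = cartier p r (H.eval F) := by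
  have hp0 := hp.out.pos
  have : CharP (MvPowerSeries σ (ZMod p)) p :=
    charP_of_injective_algebraMap (algebraMap (ZMod p) (MvPowerSeries σ (ZMod p))).injective p
  obtain ⟨G, hG⟩ := X_sub_C_dvd_sub_C_eval (a := F) (p := H)
  have hpow : (X - C F) ^ p = X ^ p - C (F ^ p) := by
    rw [sub_pow_char, C_pow]
  have hsplit : H * (X - C F) ^ (p - 1)
      = C (H.eval F) * (X - C F) ^ (p - 1) + (G * X ^ p - C (F ^ p) * G) := by
    have h1 : H = C (H.eval F) + (X - C F) * G := by rw [← hG]; ring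
    have h2 : (X - C F) * (X - C F) ^ (p - 1) = X ^ p - C (F ^ p) := by
      rw [← hpow, ← pow_succ', Nat.sub_add_cancel hp.out.one_le]
    conv_lhs => rw [h1]
    linear_combination G * h2
  -- With H = H(F) + (Y - F) G, the product is H(F)(Y - F)^(p-1) + G (Y^p - F^p). The first term
  -- contributes only its leading coefficient, at Y^(p-1). In the second, Y^p - F^p leaves the
  -- operator as Y - F, which vanishes at F.
  have key : cartierResidue p r (H * (X - C F) ^ (p - 1))
      = C (cartier p r (H.eval F)) + (X - C F) * cartierResidue p r G := by
    ext1 j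
    rw [coeff_cartierResidue hp0, hsplit, coeff_add, coeff_sub, coeff_C_mul, coeff_C_mul,
      coeff_mul_X_pow', map_add, map_sub, MvPowerSeries.cartier_pow_mul hr, coeff_add, sub_mul,
      coeff_sub, coeff_C_mul, coeff_cartierResidue hp0]
    have hdeg : ((X - C F) ^ (p - 1)).natDegree = p - 1 := by
      rw [natDegree_pow, natDegree_X_sub_C, mul_one]
    rcases j with _ | j
    · have hc : ((X - C F) ^ (p - 1)).coeff (p - 1) = 1 := by
        have := ((monic_X_sub_C F).pow (p - 1)).coeff_natDegree
        rwa [hdeg] at this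
      simp [hc, Nat.not_le.2 (Nat.sub_lt hp0 one_pos)]
    · rw [coeff_X_mul, coeff_cartierResidue hp0, coeff_C_succ, if_pos (by rw [mul_add]; omega),
        coeff_eq_zero_of_natDegree_lt (by rw [hdeg, mul_add]; omega), mul_zero, map_zero]
      congr 4
      rw [mul_add]; omega
  rw [key]
  simp

end Polynomial

/-! ### A Cartier-stable space of dimension bounded independently of p -/

namespace MvPowerSeries

variable {σ : Type*} {p : ℕ} [hp : Fact p.Prime]

theorem charP (σ : Type*) (p : ℕ) [Fact p.Prime] : CharP (MvPowerSeries σ (ZMod p)) p :=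
  charP_of_injective_algebraMap (algebraMap (ZMod p) (MvPowerSeries σ (ZMod p))).injective p

open Polynomial in
/-- A root of a bounded polynomial in characteristic `p` has a `p`-power iterate that is a root
of a bounded polynomial whose derivative does not vanish there. -/
theorem exists_root_pow_derivative_ne_zero (F : MvPowerSeries σ (ZMod p)) (d h N : ℕ) :
    ∀ (e : ℕ) (P : Polynomial (MvPowerSeries σ (ZMod p))), P.natDegree ≤ N → P ≠ 0 →
      P ∈ boundedPolynomials σ (ZMod p) (d + 1) h → P.eval (F ^ p ^ e) = 0 →
      ∃ (e : ℕ) (Q : Polynomial (MvPowerSeries σ (ZMod p))),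
        Q ∈ boundedPolynomials σ (ZMod p) (d + 1) h ∧ Q.eval (F ^ p ^ e) = 0 ∧
          Q.derivative.eval (F ^ p ^ e) ≠ 0 := by
  have := charP σ p
  induction N with
  | zero =>
    intro e P hN h0 _ hF
    rw [eq_C_of_natDegree_le_zero hN, eval_C] at hF
    rw [eq_C_of_natDegree_le_zero hN, hF, C_0] at h0
    exact absurd rfl h0
  | succ N ih =>
    intro e P hN h0 hb hF
    by_cases hd : P.derivative.eval (F ^ p ^ e) = 0
    swap
    · exact ⟨e, P, hb, hF, hd⟩
    have hpos : P.natDegree ≠ 0 := fun hz => by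
      rw [eq_C_of_natDegree_eq_zero hz, eval_C] at hF
      rw [eq_C_of_natDegree_eq_zero hz, hF, C_0] at h0
      exact h0 rfl
    -- If P' = 0, then P is a polynomial in Y^p, and contracting it trades the root for its p-th
    -- power. Otherwise P' is itself an annihilator of smaller degree. Both moves preserve the
    -- bounds.
    by_cases hz : P.derivative = 0
    · have hexp := expand_contract p hz hp.out.ne_zero
      have hdeg : P.natDegree = (contract p P).natDegree * p := by
        conv_lhs => rw [← hexp, natDegree_expand]
      refine ih (e + 1) (contract p P) ?_ ?_ ?_ ?_
      · have h1 : (contract p P).natDegree ≠ 0 := fun h => hpos (by rw [hdeg, h, zero_mul])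
        have h2 := Nat.mul_le_mul_left (contract p P).natDegree hp.out.two_le
        omega
      · intro h
        rw [h, map_zero] at hexp
        exact h0 hexp.symm
      · refine ⟨fun j hj => ?_, fun j => ?_⟩ <;> rw [coeff_contract hp.out.ne_zero]
        · exact hb.1 _ (hj.trans (Nat.le_mul_of_pos_right j hp.out.pos))
        · exact hb.2 _
      · rw [← hexp, expand_eval] at hF
        rwa [pow_succ, pow_mul]
    · refine ih e P.derivative ?_ hz ?_ hd
      · have := natDegree_derivative_lt hpos
        omega
      · refine ⟨fun j hj => ?_, fun j => ?_⟩ <;> rw [coeff_derivative]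
        · rw [hb.1 _ (by omega), zero_mul]
        · have hc := Submodule.smul_mem (boundedExponents σ (ZMod p) h) ((j : ZMod p) + 1)
            (hb.2 (j + 1))
          rw [Algebra.smul_def, mul_comm] at hc
          simpa using hc

/-- The space of power series `A(G) / P'(G)` with `A` a bounded polynomial. -/
noncomputable def residueSpace (P : Polynomial (MvPowerSeries σ (ZMod p)))
    (G : MvPowerSeries σ (ZMod p)) (d h : ℕ) : Submodule (ZMod p) (MvPowerSeries σ (ZMod p)) :=
  ((boundedPolynomials σ (ZMod p) d h).map
      (((Polynomial.aeval G).restrictScalars (ZMod p) :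
        Polynomial (MvPowerSeries σ (ZMod p)) →ₐ[ZMod p] MvPowerSeries σ (ZMod p)).toLinearMap)).comap
    (LinearMap.mulLeft (ZMod p) (P.derivative.eval G))

theorem mem_residueSpace {P : Polynomial (MvPowerSeries σ (ZMod p))}
    {G : MvPowerSeries σ (ZMod p)} {d h : ℕ} {g : MvPowerSeries σ (ZMod p)} :
    g ∈ residueSpace P G d h ↔ ∃ A ∈ boundedPolynomials σ (ZMod p) d h,
      A.eval G = P.derivative.eval G * g := by
  simp [residueSpace, Polynomial.coe_aeval_eq_eval]

/-- Multiplication by P'(G) ≠ 0 embeds the space in the values at G of the bounded polynomials. -/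
theorem finrank_residueSpace_le [Fintype σ] {P : Polynomial (MvPowerSeries σ (ZMod p))}
    {G : MvPowerSeries σ (ZMod p)} (hPG : P.derivative.eval G ≠ 0) (d h : ℕ) :
    FiniteDimensional (ZMod p) (residueSpace P G d h) ∧
      Module.finrank (ZMod p) (residueSpace P G d h) ≤ d * (h + 1) ^ Fintype.card σ := by
  obtain ⟨hfin, hrank⟩ := boundedPolynomials_finrank_le (σ := σ) (K := ZMod p) d h
  set T := (boundedPolynomials σ (ZMod p) d h).map
      (((Polynomial.aeval G).restrictScalars (ZMod p) :
        Polynomial (MvPowerSeries σ (ZMod p)) →ₐ[ZMod p] MvPowerSeries σ (ZMod p)).toLinearMap)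
    with hT
  let φ : residueSpace P G d h →ₗ[ZMod p] T :=
    (LinearMap.mulLeft (ZMod p) (P.derivative.eval G)).restrict fun x hx => hx
  have hφ : Function.Injective φ := by
    intro x y hxy
    exact Subtype.ext (mul_left_cancel₀ hPG (congrArg Subtype.val hxy))
  exact ⟨FiniteDimensional.of_injective φ hφ,
    (LinearMap.finrank_le_finrank_of_injective hφ).trans
      ((Submodule.finrank_map_le _ _).trans hrank)⟩

-- The new numerator is the section of A P^(p-1), whose Y-degree is below d + (p-1) d = p d and
-- whose exponents are at most h + (p-1) h = p h. Sections divide both bounds by p.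
open Polynomial in
theorem cartier_mem_residueSpace {P : Polynomial (MvPowerSeries σ (ZMod p))}
    {G : MvPowerSeries σ (ZMod p)} {d h : ℕ}
    (hP : P ∈ boundedPolynomials σ (ZMod p) (d + 1) h) (hG : P.eval G = 0)
    {r : σ →₀ ℕ} (hr : ∀ i, r i < p) {g : MvPowerSeries σ (ZMod p)}
    (hg : g ∈ residueSpace P G d h) : cartier p r g ∈ residueSpace P G d h := by
  rw [mem_residueSpace] at hg ⊢
  obtain ⟨A, hA, hAg⟩ := hg
  have hp0 := hp.out.pos
  obtain ⟨Q, hQ⟩ := dvd_iff_isRoot.2 hG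
  have hder : P.derivative.eval G = Q.eval G := by
    rw [hQ]; simp
  refine ⟨cartierResidue p r (A * P ^ (p - 1)), ⟨fun j hj => ?_, fun j => ?_⟩, ?_⟩
  · rw [coeff_cartierResidue hp0, (mul_pow_mem_boundedPolynomials hA hP (p - 1)).1 _ ?_, map_zero]
    have h1 : p * d ≤ p * j := Nat.mul_le_mul_left _ hj
    have h2 : d + (p - 1) * d = p * d := by
      rw [add_comm, ← Nat.succ_mul, Nat.succ_eq_add_one, Nat.sub_add_cancel hp.out.one_le]
    omega
  · rw [coeff_cartierResidue hp0]
    refine cartier_mem_boundedExponents hp0 ?_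
    have h2 : p * h = h + (p - 1) * h := by
      rw [add_comm, ← Nat.succ_mul, Nat.succ_eq_add_one, Nat.sub_add_cancel hp.out.one_le]
    rw [h2]
    exact (mul_pow_mem_boundedPolynomials hA hP (p - 1)).2 _
  · have hfac : A * P ^ (p - 1) = A * Q ^ (p - 1) * (Polynomial.X - Polynomial.C G) ^ (p - 1) := by
      rw [hQ, mul_pow]; ring
    rw [hfac, eval_cartierResidue hr, eval_mul, eval_pow, hAg, hder,
      ← cartier_pow_mul hr]
    congr 1
    rw [mul_right_comm, ← pow_succ', Nat.sub_add_cancel hp.out.one_le]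

-- The obvious numerator Y P' may have degree d. Subtracting d P, which vanishes at G, kills the
-- coefficient of Y^d.
open Polynomial in
theorem self_mem_residueSpace {P : Polynomial (MvPowerSeries σ (ZMod p))}
    {G : MvPowerSeries σ (ZMod p)} {d h : ℕ}
    (hP : P ∈ boundedPolynomials σ (ZMod p) (d + 1) h) (hG : P.eval G = 0) :
    G ∈ residueSpace P G d h := by
  rw [mem_residueSpace]
  have hcoeff : ∀ j : ℕ, (Polynomial.X * P.derivative - (d : ZMod p) • P).coeff j
      = ((j : ZMod p) - d) • P.coeff j := by
    intro j
    rw [Polynomial.coeff_sub, Polynomial.coeff_smul, sub_smul]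
    congr 1
    rcases j with _ | j
    · simp
    · rw [coeff_X_mul, coeff_derivative, Algebra.smul_def, mul_comm]
      simp
  refine ⟨Polynomial.X * P.derivative - (d : ZMod p) • P, ⟨fun j hj => ?_, fun j => ?_⟩, ?_⟩
  · rw [hcoeff]
    rcases hj.eq_or_lt with rfl | hj
    · rw [sub_self, zero_smul]
    · rw [hP.1 j hj, smul_zero]
  · rw [hcoeff]
    exact Submodule.smul_mem _ _ (hP.2 j)
  · rw [eval_sub, eval_mul, eval_X, eval_smul, hG, smul_zero, sub_zero, mul_comm]

/-- An algebraic power series over `ZMod p` lies in a space stable under the Cartier operators,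
whose dimension is bounded in terms of its degree and height only. -/
theorem exists_cartier_stable_submodule [Fintype σ] {F : MvPowerSeries σ (ZMod p)} {d h : ℕ}
    {P : Polynomial (MvPowerSeries σ (ZMod p))} (hP0 : P ≠ 0)
    (hP : P ∈ boundedPolynomials σ (ZMod p) (d + 1) h) (hF : P.eval F = 0) :
    ∃ W : Submodule (ZMod p) (MvPowerSeries σ (ZMod p)), F ∈ W ∧
      (∀ r : σ →₀ ℕ, (∀ i, r i < p) → ∀ g ∈ W, cartier p r g ∈ W) ∧
      FiniteDimensional (ZMod p) W ∧
      Module.finrank (ZMod p) W ≤ d * (h + 1) ^ Fintype.card σ := by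
  obtain ⟨e, Q, hQ, hroot, hder⟩ := exists_root_pow_derivative_ne_zero F d h P.natDegree 0 P
    le_rfl hP0 hP (by simpa using hF)
  obtain ⟨hfin, hrank⟩ := finrank_residueSpace_le hder d h
  refine ⟨residueSpace Q (F ^ p ^ e) d h, ?_,
    fun r hr g hg => cartier_mem_residueSpace hQ hroot hr hg, hfin, hrank⟩
  have hmem := self_mem_residueSpace hQ hroot
  -- The section at r = 0 extracts p-th roots, so membership descends from F^(p^e) to F.
  have hstep : ∀ k, F ^ p ^ (k + 1) ∈ residueSpace Q (F ^ p ^ e) d h →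
      F ^ p ^ k ∈ residueSpace Q (F ^ p ^ e) d h := by
    intro k hk
    have := cartier_mem_residueSpace hQ hroot (r := 0) (fun _ => hp.out.pos) hk
    rwa [pow_succ, pow_mul, ← expand_eq_pow, cartier_zero_expand] at this
  have hall : ∀ k, F ^ p ^ k ∈ residueSpace Q (F ^ p ^ e) d h →
      F ∈ residueSpace Q (F ^ p ^ e) d h := by
    intro k
    induction k with
    | zero => simp
    | succ k ih => exact fun hk => ih (hstep k hk)
  exact hall e hmem

end MvPowerSeries

/-! ### Section operators in one variable -/

namespace PowerSeries

/-- The section operator `∑ a(k) x ^ k ↦ ∑ a(p k + r) x ^ k`. -/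
noncomputable def sect {R : Type*} [CommRing R] (p r : ℕ) (f : PowerSeries R) : PowerSeries R :=
  mk fun k => coeff (p * k + r) f

/-- The exponents are split by residue class mod p; each class is X^r times a series in X^p, hence
times a p-th power. -/
theorem eq_sum_X_pow_mul_sect_pow {p : ℕ} [hp : Fact p.Prime] (f : PowerSeries (ZMod p)) :
    f = ∑ r ∈ Finset.range p, X ^ r * sect p r f ^ p := by
  have hexp : ∀ g : PowerSeries (ZMod p), g ^ p = expand p hp.out.ne_zero g :=
    fun g => (MvPowerSeries.expand_eq_pow p g).symm
  ext n
  rw [map_sum, Finset.sum_eq_single (n % p)]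
  · rw [coeff_X_pow_mul', if_pos (Nat.mod_le n p), hexp, coeff_expand,
      if_pos (Nat.dvd_sub_mod n), sect, coeff_mk, Nat.mul_div_cancel' (Nat.dvd_sub_mod n),
      Nat.sub_add_cancel (Nat.mod_le n p)]
  · intro r hr hne
    rw [coeff_X_pow_mul']
    split_ifs with hle
    · rw [hexp, coeff_expand, if_neg]
      intro hdvd
      apply hne
      rw [← Nat.mod_eq_of_lt (Finset.mem_range.1 hr)]
      exact (Nat.modEq_iff_dvd' hle).2 hdvd
    · rfl
  · intro h
    exact absurd (Finset.mem_range.2 (Nat.mod_lt n hp.out.pos)) h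

open Polynomial (coeToPowerSeries.ringHom) in
theorem exists_eq_sum_mul_pow {p N : ℕ} [hp : Fact p.Prime] {g : Fin N → PowerSeries (ZMod p)}
    (hg : ∀ r < p, ∀ v ∈ Submodule.span (ZMod p) (Set.range g),
      sect p r v ∈ Submodule.span (ZMod p) (Set.range g))
    {v : PowerSeries (ZMod p)} (hv : v ∈ Submodule.span (ZMod p) (Set.range g)) :
    ∃ b : Fin N → Polynomial (ZMod p), (∀ j, (b j).natDegree < p) ∧
      v = ∑ j, coeToPowerSeries.ringHom (b j) * g j ^ p := by
  have : CharP (PowerSeries (ZMod p)) p := MvPowerSeries.charP Unit p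
  have hex : ∀ r : Fin p, ∃ c : Fin N → ZMod p, ∑ j, c j • g j = sect p r v := fun r =>
    (Submodule.mem_span_range_iff_exists_fun (ZMod p)).1 (hg r r.2 v hv)
  choose c hc using hex
  refine ⟨fun j => ∑ r : Fin p, Polynomial.monomial (r : ℕ) (c r j ^ p), fun j => ?_, ?_⟩
  · rw [← Nat.lt_iff_le_pred hp.out.pos |>.symm.eq]
    refine Polynomial.natDegree_sum_le_of_forall_le _ _ fun r _ => ?_
    exact (Polynomial.natDegree_monomial_le _).trans (Nat.le_pred_of_lt r.2)
  · conv_lhs => rw [eq_sum_X_pow_mul_sect_pow v, Finset.sum_range]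
    simp_rw [← hc, sum_pow_char, Finset.mul_sum, map_sum, Finset.sum_mul]
    rw [Finset.sum_comm]
    refine Finset.sum_congr rfl fun j _ => Finset.sum_congr rfl fun r _ => ?_
    rw [← Polynomial.C_mul_X_pow_eq_monomial]
    simp only [map_mul, map_pow, Polynomial.coeToPowerSeries.ringHom_apply, Polynomial.coe_C,
      Polynomial.coe_X, smul_eq_C_mul]
    ring

-- The one-step expansion of each g j is raised to the power p^k and substituted. Degrees add up to
-- less than p^k + p^k (p - 1) = p^(k+1).
open Polynomial (coeToPowerSeries.ringHom) in
theorem exists_eq_sum_mul_pow_pow {p N : ℕ} [hp : Fact p.Prime]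
    {g : Fin N → PowerSeries (ZMod p)}
    (hg : ∀ r < p, ∀ v ∈ Submodule.span (ZMod p) (Set.range g),
      sect p r v ∈ Submodule.span (ZMod p) (Set.range g))
    {v : PowerSeries (ZMod p)} (hv : v ∈ Submodule.span (ZMod p) (Set.range g)) (k : ℕ) :
    ∃ a : Fin N → Polynomial (ZMod p), (∀ j, (a j).natDegree < p ^ k) ∧
      v = ∑ j, coeToPowerSeries.ringHom (a j) * g j ^ p ^ k := by
  have : CharP (PowerSeries (ZMod p)) p := MvPowerSeries.charP Unit p
  induction k with
  | zero =>
    obtain ⟨c, hc⟩ := (Submodule.mem_span_range_iff_exists_fun (ZMod p)).1 hv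
    refine ⟨fun j => Polynomial.C (c j), by simp, ?_⟩
    rw [← hc]
    simp [smul_eq_C_mul]
  | succ k ih =>
    obtain ⟨a, ha, hva⟩ := ih
    have hmem : ∀ j, g j ∈ Submodule.span (ZMod p) (Set.range g) := fun j =>
      Submodule.subset_span ⟨j, rfl⟩
    choose b hb hgb using fun j => exists_eq_sum_mul_pow hg (hmem j)
    refine ⟨fun i => ∑ j, a j * b j i ^ p ^ k, fun i => ?_, ?_⟩
    · have hpos : 0 < p ^ (k + 1) := pow_pos hp.out.pos _
      refine Nat.lt_of_le_pred hpos
        (Polynomial.natDegree_sum_le_of_forall_le _ _ fun j _ => Nat.le_pred_of_lt ?_)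
      have h1 := Polynomial.natDegree_mul_le (p := a j) (q := b j i ^ p ^ k)
      have h2 := Polynomial.natDegree_pow_le (p := b j i) (n := p ^ k)
      have h3 : p ^ k * (b j i).natDegree ≤ p ^ k * (p - 1) :=
        Nat.mul_le_mul_left _ (Nat.le_pred_of_lt (hb j i))
      have h4 : p ^ (k + 1) = p ^ k * (p - 1) + p ^ k := by
        rw [← Nat.mul_succ, Nat.succ_eq_add_one, Nat.sub_add_cancel hp.out.one_le, pow_succ]
      have := ha j
      omega
    · conv_lhs => rw [hva]
      have hpow : ∀ j, g j ^ p ^ k = ∑ i, coeToPowerSeries.ringHom (b j i) ^ p ^ k *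
          g i ^ p ^ (k + 1) := by
        intro j
        conv_lhs => rw [hgb j]
        rw [sum_pow_char_pow]
        refine Finset.sum_congr rfl fun i _ => ?_
        rw [mul_pow, ← pow_mul, ← pow_succ']
      simp_rw [hpow, Finset.mul_sum, map_sum, Finset.sum_mul]
      rw [Finset.sum_comm]
      refine Finset.sum_congr rfl fun i _ => Finset.sum_congr rfl fun j _ => ?_
      rw [map_mul, map_pow, mul_assoc]

end PowerSeries

/-! ### From linear relations to annihilating polynomials -/

namespace Polynomial

/-- `N + 1` vectors of length `N` with polynomial entries satisfy a linear relation with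
coefficients of bounded degree. -/
theorem exists_linear_relation {K : Type*} [Field K] {N M : ℕ}
    (α : Fin (N + 1) → Fin N → Polynomial K) (hα : ∀ k j, (α k j).natDegree ≤ M) :
    ∃ c : Fin (N + 1) → Polynomial K, c ≠ 0 ∧ (∀ k, (c k).natDegree ≤ N * M) ∧
      ∀ j, ∑ k, c k * α k j = 0 := by
  have hfr : ∀ n : ℕ, Module.finrank K (degreeLT K n) = n := fun n => by
    rw [(degreeLTEquiv K n).finrank_eq, Module.finrank_fin_fun]
  have hfin : ∀ n : ℕ, FiniteDimensional K (degreeLT K n) := fun n =>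
    (degreeLTEquiv K n).symm.finiteDimensional
  have hmem : ∀ (n : ℕ) (f : Polynomial K), f ∈ degreeLT K (n + 1) ↔ f.natDegree ≤ n := by
    intro n f
    rw [mem_degreeLT, degree_lt_iff_coeff_zero, natDegree_le_iff_coeff_eq_zero]
    rfl
  let Φ₀ : (Fin (N + 1) → degreeLT K (N * M + 1)) →ₗ[K] (Fin N → Polynomial K) :=
    LinearMap.pi fun j => ∑ k, (LinearMap.mulRight K (α k j)) ∘ₗ (degreeLT K (N * M + 1)).subtype
      ∘ₗ LinearMap.proj k
  have hΦ₀ : ∀ c j, Φ₀ c j = ∑ k, (c k : Polynomial K) * α k j := by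
    intro c j; simp [Φ₀]
  let Φ : (Fin (N + 1) → degreeLT K (N * M + 1)) →ₗ[K]
      (Fin N → degreeLT K (N * M + M + 1)) :=
    LinearMap.pi fun j => (LinearMap.proj j ∘ₗ Φ₀).codRestrict _ fun c => by
      rw [LinearMap.comp_apply, LinearMap.proj_apply, hΦ₀, hmem]
      refine natDegree_sum_le_of_forall_le _ _ fun k _ => natDegree_mul_le.trans ?_
      exact add_le_add ((hmem _ _).1 (c k).2) (hα k j)
  -- There are (N+1)(NM+1) unknowns against N(NM+M+1) equations: exactly one more.
  have hker : LinearMap.ker Φ ≠ ⊥ := by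
    refine Φ.ker_ne_bot_of_finrank_lt ?_
    rw [Module.finrank_pi_fintype, Module.finrank_pi_fintype]
    simp only [hfr, Finset.sum_const, Finset.card_univ, Fintype.card_fin, smul_eq_mul]
    ring_nf
    omega
  obtain ⟨c, hc, hc0⟩ := Submodule.exists_mem_ne_zero_of_ne_bot hker
  refine ⟨fun k => c k, fun h => hc0 ?_, fun k => (hmem _ _).1 (c k).2, fun j => ?_⟩
  · ext1 k
    exact Subtype.ext (congrFun h k)
  · rw [← hΦ₀]
    exact congrArg Subtype.val (congrFun (LinearMap.mem_ker.1 hc) j)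

end Polynomial

namespace AlgSeries

open Polynomial in
/-- A one-variable power series over `ZMod p` that lies in an `N`-dimensional space stable under
the section operators is algebraic, with explicit bounds. -/
theorem exists_annihilator_of_sect_stable {p N : ℕ} [hp : Fact p.Prime]
    {g : Fin N → PowerSeries (ZMod p)}
    (hg : ∀ r < p, ∀ v ∈ Submodule.span (ZMod p) (Set.range g),
      PowerSeries.sect p r v ∈ Submodule.span (ZMod p) (Set.range g))
    {v : PowerSeries (ZMod p)} (hv : v ∈ Submodule.span (ZMod p) (Set.range g)) :
    ∃ P : Polynomial (MvPolynomial Unit (ZMod p)), P ≠ 0 ∧ P.natDegree ≤ p ^ N ∧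
      polyHeight P ≤ N * p ^ N ∧ Polynomial.aeval (v : MvPowerSeries Unit (ZMod p)) P = 0 := by
  have : CharP (PowerSeries (ZMod p)) p := MvPowerSeries.charP Unit p
  choose a ha hva using fun k => PowerSeries.exists_eq_sum_mul_pow_pow hg hv k
  -- Expanding v to depth N - k before raising it to the power p^k makes all these powers
  -- combinations of the same g j ^ p^N.
  have hvk : ∀ k ≤ N, v ^ p ^ k
      = ∑ j, coeToPowerSeries.ringHom (a (N - k) j ^ p ^ k) * g j ^ p ^ N := by
    intro k hk
    conv_lhs => rw [hva (N - k)]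
    rw [sum_pow_char_pow]
    refine Finset.sum_congr rfl fun j _ => ?_
    rw [mul_pow, map_pow, ← pow_mul, ← pow_add, Nat.sub_add_cancel hk]
  have hdeg : ∀ (k : Fin (N + 1)) (j : Fin N),
      (a (N - k) j ^ p ^ (k : ℕ)).natDegree ≤ p ^ N := by
    intro k j
    refine natDegree_pow_le.trans ((Nat.mul_le_mul_left _ (ha (N - k) j).le).trans ?_)
    rw [← pow_add, Nat.add_sub_cancel' (Nat.le_of_lt_succ k.2)]
  obtain ⟨c, hc0, hcdeg, hc⟩ := exists_linear_relation _ hdeg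
  let ψ := (MvPolynomial.uniqueAlgEquiv (ZMod p) Unit).symm
  have hψmon : ∀ (n : ℕ) (r : ZMod p), ψ (Polynomial.monomial n r)
      = MvPolynomial.monomial (Finsupp.single () n) r := fun n r => by
    have := MvPolynomial.uniqueAlgEquiv_symm_monomial (R := ZMod p) (σ := Unit) (r := r)
      (d := Finsupp.single () n)
    rwa [show Finsupp.single () n default = n from Finsupp.single_eq_same] at this
  have hψ : ∀ f : Polynomial (ZMod p),
      algebraMap (MvPolynomial Unit (ZMod p)) (MvPowerSeries Unit (ZMod p)) (ψ f)
        = coeToPowerSeries.ringHom f := by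
    intro f
    induction f using Polynomial.induction_on' with
    | add f g hf hg => rw [map_add, map_add, hf, hg, map_add]
    | monomial n r =>
      rw [hψmon, MvPowerSeries.algebraMap_apply', MvPolynomial.coe_monomial, Algebra.algebraMap_self,
        MvPowerSeries.map_id, RingHom.id_apply, coeToPowerSeries.ringHom_apply,
        Polynomial.coe_monomial]
      rfl
  have hψdeg : ∀ f : Polynomial (ZMod p), (ψ f).totalDegree ≤ f.natDegree := by
    intro f
    conv_lhs => rw [f.as_sum_range, map_sum]
    refine MvPolynomial.totalDegree_finsetSum_le fun n hn => ?_
    rw [hψmon]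
    refine (MvPolynomial.totalDegree_monomial_le _ _).trans ?_
    rw [Finset.mem_range] at hn
    simpa using Nat.le_of_lt_succ hn
  -- Distinct exponents p^k keep the monomials apart, so c ≠ 0 yields a nonzero polynomial.
  have hinj : Function.Injective fun k : Fin (N + 1) => p ^ (k : ℕ) := fun x y hxy =>
    Fin.ext (Nat.pow_right_injective hp.out.two_le hxy)
  refine ⟨∑ k : Fin (N + 1), monomial (p ^ (k : ℕ)) (ψ (c k)), ?_, ?_, ?_, ?_⟩
  · intro h0
    apply hc0
    ext1 k
    have := congrArg (fun P => P.coeff (p ^ (k : ℕ))) h0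
    simp only [finsetSum_coeff, coeff_monomial, coeff_zero] at this
    rw [Finset.sum_eq_single k (fun j _ hj => if_neg fun h => hj (hinj h)) (by simp),
      if_pos rfl] at this
    simpa using this
  · refine natDegree_sum_le_of_forall_le _ _ fun k _ => (natDegree_monomial_le _).trans ?_
    exact Nat.pow_le_pow_right hp.out.pos (Nat.le_of_lt_succ k.2)
  · refine Finset.sup_le fun i _ => ?_
    rw [finsetSum_coeff]
    refine MvPolynomial.totalDegree_finsetSum_le fun k _ => ?_
    rw [coeff_monomial]
    split_ifs
    · exact (hψdeg _).trans (hcdeg k)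
    · simp
  · rw [map_sum]
    simp_rw [aeval_monomial, hψ]
    have hterm : ∀ k : Fin (N + 1), coeToPowerSeries.ringHom (c k) * v ^ p ^ (k : ℕ)
        = ∑ j, coeToPowerSeries.ringHom (c k * a (N - k) j ^ p ^ (k : ℕ)) * g j ^ p ^ N := by
      intro k
      rw [hvk k (Nat.le_of_lt_succ k.2), Finset.mul_sum]
      refine Finset.sum_congr rfl fun j _ => ?_
      rw [map_mul, mul_assoc]
    refine (Finset.sum_congr rfl fun k _ => hterm k).trans ?_
    rw [Finset.sum_comm]
    refine Finset.sum_eq_zero fun j _ => ?_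
    rw [← Finset.sum_mul, ← map_sum, hc j, map_zero, zero_mul]

end AlgSeries

/-! ### Height as a degree, and its monotonicity under division -/

namespace MvPolynomial

variable {σ K : Type*} [Field K]

/-- The ring homomorphism that records the total degree in `x` as the degree in a new variable. -/
noncomputable def gradeX (σ K : Type*) [Field K] :
    MvPolynomial σ K →ₐ[K] Polynomial (Polynomial (MvPolynomial σ K)) :=
  aeval fun s => Polynomial.C (Polynomial.C (X s)) * Polynomial.X

theorem _root_.Finsupp.prod_mul_pow {B : Type*} [CommSemiring B] (m : σ →₀ ℕ) (y : σ → B) (t : B) :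
    (m.prod fun s e => (y s * t) ^ e) = (m.prod fun s e => y s ^ e) * t ^ m.degree := by
  simp [Finsupp.prod, mul_pow, Finset.prod_mul_distrib, Finset.prod_pow_eq_pow_sum,
    Finsupp.degree_apply]

theorem coeff_gradeX (f : MvPolynomial σ K) (k : ℕ) :
    (gradeX σ K f).coeff k = Polynomial.C (homogeneousComponent k f) := by
  induction f using MvPolynomial.induction_on' with
  | add f g hf hg => rw [map_add, Polynomial.coeff_add, hf, hg, map_add, map_add]
  | monomial m a =>
    have h1 : gradeX σ K (monomial m a)
        = Polynomial.C (Polynomial.C (monomial m a)) * Polynomial.X ^ m.degree := by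
      rw [gradeX, aeval_monomial, monomial_eq, Polynomial.C_mul, Polynomial.C_mul, mul_assoc]
      congr 1
      refine (Finsupp.prod_mul_pow m _ _).trans ?_
      simp only [map_finsuppProd, map_pow]
    rw [h1, Polynomial.coeff_C_mul, Polynomial.coeff_X_pow,
      homogeneousComponent_of_mem (isHomogeneous_monomial a rfl)]
    split_ifs <;> simp

end MvPolynomial

namespace AlgSeries

variable {σ K : Type*} [Field K]

/-- `gradeX` applied to the coefficients of a polynomial in `Y`. -/
noncomputable def gradePoly (σ K : Type*) [Field K] :
    Polynomial (MvPolynomial σ K) →+* Polynomial (Polynomial (MvPolynomial σ K)) :=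
  Polynomial.eval₂RingHom (MvPolynomial.gradeX σ K).toRingHom 
    (Polynomial.C (Polynomial.X : Polynomial (MvPolynomial σ K)))

theorem coeff_coeff_gradePoly (P : Polynomial (MvPolynomial σ K)) (k i : ℕ) :
    ((gradePoly σ K P).coeff k).coeff i = MvPolynomial.homogeneousComponent k (P.coeff i) := by
  induction P using Polynomial.induction_on' with
  | add P Q hP hQ => simp only [map_add, Polynomial.coeff_add, hP, hQ]
  | monomial n a =>
    have h1 : gradePoly σ K (Polynomial.monomial n a)
        = MvPolynomial.gradeX σ K a * Polynomial.C (Polynomial.X ^ n) := by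
      simp [gradePoly]
    rw [h1, Polynomial.coeff_mul_C, MvPolynomial.coeff_gradeX, Polynomial.coeff_C_mul,
      Polynomial.coeff_X_pow, Polynomial.coeff_monomial]
    by_cases h : i = n
    · simp [h]
    · simp [h, Ne.symm h]

theorem totalDegree_coeff_le_polyHeight (P : Polynomial (MvPolynomial σ K)) (i : ℕ) :
    (P.coeff i).totalDegree ≤ polyHeight P := by
  by_cases h : P.coeff i = 0
  · simp [h]
  · exact Finset.le_sup (f := fun i => (P.coeff i).totalDegree) (Polynomial.mem_support_iff.2 h)

theorem natDegree_gradePoly_le (P : Polynomial (MvPolynomial σ K)) :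
    (gradePoly σ K P).natDegree ≤ polyHeight P := by
  rw [Polynomial.natDegree_le_iff_coeff_eq_zero]
  intro k hk
  ext1 i
  rw [coeff_coeff_gradePoly, MvPolynomial.homogeneousComponent_eq_zero _ _
    ((totalDegree_coeff_le_polyHeight P i).trans_lt hk), Polynomial.coeff_zero]

theorem homogeneousComponent_totalDegree_ne_zero {f : MvPolynomial σ K} (hf : f ≠ 0) :
    MvPolynomial.homogeneousComponent f.totalDegree f ≠ 0 := by
  classical
  obtain ⟨m, hm, hdeg⟩ := Finset.exists_mem_eq_sup f.support
    (MvPolynomial.support_nonempty.2 hf) fun s => s.sum fun _ e => e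
  intro h
  have := congrArg (MvPolynomial.coeff m) h
  rw [MvPolynomial.coeff_homogeneousComponent, if_pos, MvPolynomial.coeff_zero] at this
  · exact MvPolynomial.mem_support_iff.1 hm this
  · exact hdeg.symm

theorem totalDegree_coeff_le_natDegree_gradePoly (P : Polynomial (MvPolynomial σ K)) (i : ℕ) :
    (P.coeff i).totalDegree ≤ (gradePoly σ K P).natDegree := by
  by_cases h : P.coeff i = 0
  · simp [h]
  · refine Polynomial.le_natDegree_of_ne_zero fun h0 => ?_
    have := coeff_coeff_gradePoly P (P.coeff i).totalDegree i
    rw [h0, Polynomial.coeff_zero] at this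
    exact homogeneousComponent_totalDegree_ne_zero h this.symm

/-- Substituting x_s t for x_s turns the height into the degree in t, and degrees over a domain add
under multiplication. -/
theorem polyHeight_le_of_dvd {P Q : Polynomial (MvPolynomial σ K)} (hP : P ≠ 0) (h : Q ∣ P) :
    polyHeight Q ≤ polyHeight P := by
  refine Finset.sup_le fun i _ => (totalDegree_coeff_le_natDegree_gradePoly Q i).trans ?_
  refine (Polynomial.natDegree_le_of_dvd (map_dvd (gradePoly σ K) h) fun h0 => hP ?_).trans
    (natDegree_gradePoly_le P)
  ext1 i
  by_contra hi
  have := coeff_coeff_gradePoly P (P.coeff i).totalDegree i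
  rw [h0, Polynomial.coeff_zero, Polynomial.coeff_zero] at this
  exact homogeneousComponent_totalDegree_ne_zero hi this.symm

/-! ### Annihilators of least degree and height -/

theorem algebraMap_injective (σ R : Type*) [CommRing R] :
    Function.Injective (algebraMap (MvPolynomial σ R) (MvPowerSeries σ R)) := by
  intro a b h
  rw [MvPowerSeries.algebraMap_apply', MvPowerSeries.algebraMap_apply'] at h
  simpa using h

/-- An irreducible annihilating polynomial has the least degree. -/
theorem natDegree_le_of_irreducible {A B : Type*} (L M : Type*) [Field L] [Field M] [CommRing A] [IsDomain A]
    [UniqueFactorizationMonoid A] [CommRing B] [Algebra A B] [Algebra A L]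
    [IsFractionRing A L] [Algebra B M] [IsFractionRing B M]
    (hinj : Function.Injective (algebraMap A B)) {f : B} {P Q : Polynomial A}
    (hQ : Irreducible Q) (hQf : Polynomial.aeval f Q = 0) (hP : P ≠ 0)
    (hPf : Polynomial.aeval f P = 0) : Q.natDegree ≤ P.natDegree := by
  have hinjM : Function.Injective ((algebraMap B M).comp (algebraMap A B)) :=
    (IsFractionRing.injective B M).comp hinj
  let θ : L →+* M := IsFractionRing.lift hinjM
  have hθ : θ.comp (algebraMap A L) = (algebraMap B M).comp (algebraMap A B) :=
    RingHom.ext fun x => IsFractionRing.lift_algebraMap hinjM x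
  have heval : ∀ S : Polynomial A, Polynomial.aeval f S = 0 →
      Polynomial.eval₂ θ (algebraMap _ M f) (S.map (algebraMap _ L)) = 0 := by
    intro S hS
    rw [Polynomial.eval₂_map, hθ, ← Polynomial.hom_eval₂, ← Polynomial.aeval_def, hS, map_zero]
  have hdeg : Q.natDegree ≠ 0 := fun h => by
    rw [Polynomial.eq_C_of_natDegree_eq_zero h, Polynomial.aeval_C,
      map_eq_zero_iff _ hinj] at hQf
    apply hQ.ne_zero
    rw [Polynomial.eq_C_of_natDegree_eq_zero h, hQf, Polynomial.C_0]
  have hirr : Irreducible (Q.map (algebraMap _ L)) :=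
    ((hQ.isPrimitive hdeg).irreducible_iff_irreducible_map_fraction_map).1 hQ
  have hLinj := IsFractionRing.injective A L
  by_cases hdvd : Q.map (algebraMap _ L) ∣ P.map (algebraMap _ L)
  swap
  -- By Gauss's lemma Q stays irreducible over the fraction field. Were it coprime to P, a Bézout
  -- identity evaluated at f would read 0 = 1.
  · have hco := hirr.coprime_iff_not_dvd.2 hdvd
    obtain ⟨a, b, hab⟩ := hco
    have := congrArg (Polynomial.eval₂ θ (algebraMap _ M f)) hab
    rw [Polynomial.eval₂_add, Polynomial.eval₂_mul, Polynomial.eval₂_mul, heval Q hQf,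
      heval P hPf, Polynomial.eval₂_one, mul_zero, mul_zero, add_zero] at this
    exact absurd this zero_ne_one
  · have := Polynomial.natDegree_le_of_dvd hdvd ((Polynomial.map_ne_zero_iff hLinj).2 hP)
    rwa [Polynomial.natDegree_map_eq_of_injective hLinj,
      Polynomial.natDegree_map_eq_of_injective hLinj] at this

/-- Some annihilating polynomial attains the bounds by degree and height simultaneously. -/
theorem IsAlgebraicSeries.exists_annihilator {f : MvPowerSeries σ K} (hf : IsAlgebraicSeries f) :
    ∃ P : Polynomial (MvPolynomial σ K), P ≠ 0 ∧ P.natDegree ≤ degree f ∧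
      polyHeight P ≤ height f ∧ Polynomial.aeval f P = 0 := by
  have : IsDomain (MvPowerSeries σ K) := NoZeroDivisors.to_isDomain _
  obtain ⟨P₀, hP₀, hP₀f⟩ := hf
  obtain ⟨-, P, hP, hPd, hPf⟩ : degree f ∈ {m | 0 < m ∧ ∃ P : Polynomial (MvPolynomial σ K),
      P ≠ 0 ∧ P.natDegree ≤ m ∧ Polynomial.aeval f P = 0} :=
    Nat.sInf_mem ⟨P₀.natDegree + 1, Nat.succ_pos _, P₀, hP₀, Nat.le_succ _, hP₀f⟩
  obtain ⟨S, hS, hSf, hSh⟩ : height f ∈ {H | ∃ P : Polynomial (MvPolynomial σ K),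
      P ≠ 0 ∧ Polynomial.aeval f P = 0 ∧ polyHeight P = H} :=
    Nat.sInf_mem ⟨_, P₀, hP₀, hP₀f, rfl⟩
  -- Some irreducible factor of the least-height annihilator S kills f. It inherits the height bound
  -- as a divisor and the degree bound by irreducibility.
  obtain ⟨s, hirr, hs⟩ := WfDvdMonoid.exists_factors S hS
  have hprod : (s.map (Polynomial.aeval f)).prod = 0 := by
    obtain ⟨u, hu⟩ := hs.symm
    rw [← map_multiset_prod, ← hu, map_mul, hSf, zero_mul]
  rw [Multiset.prod_eq_zero_iff, Multiset.mem_map] at hprod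
  obtain ⟨Q, hQs, hQf⟩ := hprod
  refine ⟨Q, (hirr Q hQs).ne_zero,
    (natDegree_le_of_irreducible (FractionRing (MvPolynomial σ K))
      (FractionRing (MvPowerSeries σ K)) (algebraMap_injective σ K) (hirr Q hQs) hQf hP hPf).trans hPd, ?_, hQf⟩
  rw [← hSh]
  exact polyHeight_le_of_dvd hS ((Multiset.dvd_prod hQs).trans hs.dvd)

/-! ### Reduction modulo p -/

theorem map_aeval {A B : Type*} [CommRing A] [CommRing B] (φ : A →+* B) (f : MvPowerSeries σ A)
    (P : Polynomial (MvPolynomial σ A)) :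
    MvPowerSeries.map φ (Polynomial.aeval f P)
      = Polynomial.aeval (MvPowerSeries.map φ f) (P.map (MvPolynomial.map φ)) := by
  rw [Polynomial.aeval_def, Polynomial.aeval_def, Polynomial.hom_eval₂, Polynomial.eval₂_map]
  congr 1

theorem exists_integer_multiple (q : MvPolynomial σ ℚ) :
    ∃ b : ℤ, b ≠ 0 ∧ ∃ q' : MvPolynomial σ ℤ,
      MvPolynomial.map (Int.castRingHom ℚ) q' = MvPolynomial.C (b : ℚ) * q := by
  induction q using MvPolynomial.induction_on' with
  | add q r hq hr =>
    obtain ⟨b, hb, q', hq'⟩ := hq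
    obtain ⟨c, hc, r', hr'⟩ := hr
    refine ⟨b * c, mul_ne_zero hb hc, MvPolynomial.C c * q' + MvPolynomial.C b * r', ?_⟩
    rw [map_add, map_mul, map_mul, hq', hr', MvPolynomial.map_C, MvPolynomial.map_C]
    push_cast
    rw [map_mul]
    simp only [eq_intCast]
    ring
  | monomial m a =>
    refine ⟨a.den, by exact_mod_cast a.den_ne_zero, MvPolynomial.monomial m a.num, ?_⟩
    rw [MvPolynomial.map_monomial, MvPolynomial.C_mul_monomial]
    congr 1
    simp [Rat.den_mul_eq_num]

theorem exists_integer_multiple_polynomial (P : Polynomial (MvPolynomial σ ℚ)) :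
    ∃ b : ℤ, b ≠ 0 ∧ ∃ P' : Polynomial (MvPolynomial σ ℤ),
      P'.map (MvPolynomial.map (Int.castRingHom ℚ))
        = Polynomial.C (MvPolynomial.C (b : ℚ)) * P := by
  induction P using Polynomial.induction_on' with
  | add q r hq hr =>
    obtain ⟨b, hb, q', hq'⟩ := hq
    obtain ⟨c, hc, r', hr'⟩ := hr
    refine ⟨b * c, mul_ne_zero hb hc, Polynomial.C (MvPolynomial.C c) * q'
      + Polynomial.C (MvPolynomial.C b) * r', ?_⟩
    rw [Polynomial.map_add, Polynomial.map_mul, Polynomial.map_mul, hq', hr', Polynomial.map_C,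
      Polynomial.map_C, MvPolynomial.map_C, MvPolynomial.map_C]
    push_cast
    rw [map_mul, map_mul]
    simp only [eq_intCast]
    ring
  | monomial n a =>
    obtain ⟨b, hb, q', hq'⟩ := exists_integer_multiple a
    refine ⟨b, hb, Polynomial.monomial n q', ?_⟩
    rw [Polynomial.map_monomial, hq', Polynomial.C_mul_monomial]

/-- The full power of p dividing P is removed, so that reduction mod p does not vanish. -/
theorem exists_not_dvd_and_eq_mul [Finite σ] (p : ℕ) [hp : Fact p.Prime]
    {P : Polynomial (MvPolynomial σ ℤ)} (hP : P ≠ 0) :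
    ∃ (b : ℤ) (Q : Polynomial (MvPolynomial σ ℤ)), b ≠ 0 ∧
      P = Polynomial.C (MvPolynomial.C b) * Q ∧
      Q.map (MvPolynomial.map (Int.castRingHom (ZMod p))) ≠ 0 := by
  have hpr : Prime (p : ℤ) := Nat.prime_iff_prime_int.1 hp.out
  have hpC : ¬ IsUnit (Polynomial.C (MvPolynomial.C (σ := σ) (p : ℤ))) := by
    rw [Polynomial.isUnit_C]
    exact ((MvPolynomial.prime_C_iff σ).2 hpr).not_isUnit
  obtain ⟨Q, hPQ, hQ⟩ := (FiniteMultiplicity.of_not_isUnit hpC hP).exists_eq_pow_mul_and_not_dvd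
  refine ⟨(p : ℤ) ^ multiplicity (Polynomial.C (MvPolynomial.C (σ := σ) (p : ℤ))) P, Q, pow_ne_zero _ hpr.ne_zero, ?_, fun h0 => hQ ?_⟩
  · rw [map_pow, map_pow]
    exact hPQ
  · refine (Polynomial.C_dvd_iff_dvd_coeff _ _).2 fun i => ?_
    rw [← Int.cast_natCast, Int.cast_id, MvPolynomial.C_dvd_iff_zmod, ← Polynomial.coeff_map, h0,
      Polynomial.coeff_zero]

/-- Reduction of algebraicity modulo `p`, with the bounds preserved. -/
theorem exists_annihilator_mod [Finite σ] (p : ℕ) [hp : Fact p.Prime] {f : MvPowerSeries σ ℤ}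
    {d h : ℕ} (hf : IsAlgebraicSeries (MvPowerSeries.map (Int.castRingHom ℚ) f))
    (hd : degree (MvPowerSeries.map (Int.castRingHom ℚ) f) ≤ d)
    (hh : height (MvPowerSeries.map (Int.castRingHom ℚ) f) ≤ h) :
    ∃ P : Polynomial (MvPowerSeries σ (ZMod p)), P ≠ 0 ∧
      P ∈ MvPowerSeries.boundedPolynomials σ (ZMod p) (d + 1) h ∧
      P.eval (MvPowerSeries.map (Int.castRingHom (ZMod p)) f) = 0 := by
  obtain ⟨P, hP, hPd, hPh, hPf⟩ := hf.exists_annihilator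
  obtain ⟨b, hb, P', hP'⟩ := exists_integer_multiple_polynomial P
  have hP'0 : P' ≠ 0 := by
    rintro rfl
    rw [Polynomial.map_zero] at hP'
    exact mul_ne_zero (by simpa using hb) hP hP'.symm
  obtain ⟨c, Q, hc, hQ, hQp⟩ := exists_not_dvd_and_eq_mul p hP'0
  have hP'f : Polynomial.aeval f P' = 0 := by
    have hinj : Function.Injective (MvPowerSeries.map (σ := σ) (Int.castRingHom ℚ)) := by
      intro x y hxy
      ext m
      have := congrArg (MvPowerSeries.coeff m) hxy
      simpa using this
    apply hinj
    rw [map_aeval, hP', map_mul, hPf, mul_zero, map_zero]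
  have hQf : Polynomial.aeval f Q = 0 := by
    rw [hQ, map_mul, Polynomial.aeval_C] at hP'f
    refine (mul_eq_zero.1 hP'f).resolve_left ?_
    rw [map_eq_zero_iff _ (algebraMap_injective σ ℤ)]
    simpa using hc
  -- Over ℚ, Q is a nonzero constant multiple of P, so its support lies in that of P; a single
  -- exponent is at most the total degree.
  have hcoeff : ∀ j m, MvPolynomial.coeff m (Q.coeff j) ≠ 0 → j ≤ d ∧ ∀ i, m i ≤ h := by
    intro j m hne
    have h1 : MvPolynomial.coeff m (P.coeff j) ≠ 0 := by
      intro h0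
      have := congrArg (fun S => MvPolynomial.coeff m (Polynomial.coeff S j)) hP'
      rw [hQ] at this
      simp only [Polynomial.coeff_map, Polynomial.coeff_C_mul, MvPolynomial.coeff_map,
        MvPolynomial.coeff_C_mul, h0, mul_zero] at this
      rw [eq_intCast, Int.cast_eq_zero] at this
      exact mul_ne_zero hc hne this
    refine ⟨?_, fun i => ?_⟩
    · refine (Polynomial.le_natDegree_of_ne_zero fun h0 => h1 ?_).trans (hPd.trans hd)
      rw [h0, MvPolynomial.coeff_zero]
    · refine le_trans ?_ ((totalDegree_coeff_le_polyHeight P j).trans (hPh.trans hh))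
      refine le_trans ?_ (MvPolynomial.le_totalDegree (MvPolynomial.mem_support_iff.2 h1))
      by_cases hi : m i = 0
      · simp [hi]
      · exact Finset.single_le_sum (f := m) (fun _ _ => Nat.zero_le _)
          (Finsupp.mem_support_iff.2 hi)
  have hinj := algebraMap_injective σ (ZMod p)
  refine ⟨(Q.map (MvPolynomial.map (Int.castRingHom (ZMod p)))).map
    (algebraMap _ (MvPowerSeries σ (ZMod p))), (Polynomial.map_ne_zero_iff hinj).2 hQp,
    ⟨fun j hj => ?_, fun j m hm i => ?_⟩, ?_⟩
  · rw [Polynomial.coeff_map, Polynomial.coeff_map, map_eq_zero_iff _ hinj]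
    ext m
    rw [MvPolynomial.coeff_map, MvPolynomial.coeff_zero]
    by_cases h0 : MvPolynomial.coeff m (Q.coeff j) = 0
    · rw [h0, map_zero]
    · have := (hcoeff j m h0).1
      omega
  · refine (hcoeff j m fun h0 => hm ?_).2 i
    rw [Polynomial.coeff_map, Polynomial.coeff_map, MvPowerSeries.algebraMap_apply',
      Algebra.algebraMap_self, MvPowerSeries.map_id, RingHom.id_apply, MvPolynomial.coeff_coe,
      MvPolynomial.coeff_map, h0, map_zero]
  · rw [Polynomial.eval_map, ← Polynomial.aeval_def, ← map_aeval, hQf, map_zero]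

end AlgSeries

/-! ### Diagonals and the explicit bound -/

namespace AlgSeries

/-- Both sides have k-th coefficient a(pk + r, …, pk + r). Hence the diagonal carries Cartier-stable
spaces to section-stable ones. -/
theorem sect_diagonal {n : ℕ} {R : Type*} [CommRing R] (p r : ℕ) (f : MvPowerSeries (Fin n) R) :
    PowerSeries.sect p r (diagonal f)
      = diagonal (MvPowerSeries.cartier p (Finsupp.equivFunOnFinite.symm fun _ => r) f) := by
  ext k
  simp only [PowerSeries.sect, diagonal, PowerSeries.coeff_mk, MvPowerSeries.coeff_cartier]
  congr 2
  ext i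
  simp

theorem map_diagonal {n : ℕ} {R S : Type*} [CommRing R] [CommRing S] (φ : R →+* S)
    (f : MvPowerSeries (Fin n) R) :
    PowerSeries.map φ (diagonal f) = diagonal (MvPowerSeries.map φ f) := by
  ext k
  simp [diagonal]

/-- The diagonal as a linear map. -/
noncomputable def diagonalLinearMap (n : ℕ) (R : Type*) [CommRing R] :
    MvPowerSeries (Fin n) R →ₗ[R] PowerSeries R where
  toFun := diagonal
  map_add' f g := by ext; simp [diagonal]
  map_smul' c f := by ext; simp [diagonal]

/-- The diagonal modulo `p` of an algebraic power series has an annihilating polynomial whose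
degree and height are bounded explicitly. -/
theorem exists_annihilator_diagonal {n d h p : ℕ} [hp : Fact p.Prime]
    {F : MvPowerSeries (Fin n) (ZMod p)} {P : Polynomial (MvPowerSeries (Fin n) (ZMod p))}
    (hP0 : P ≠ 0) (hP : P ∈ MvPowerSeries.boundedPolynomials (Fin n) (ZMod p) (d + 1) h)
    (hF : P.eval F = 0) :
    ∃ N ≤ d * (h + 1) ^ n, ∃ Q : Polynomial (MvPolynomial Unit (ZMod p)), Q ≠ 0 ∧
      Q.natDegree ≤ p ^ N ∧ polyHeight Q ≤ N * p ^ N ∧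
      Polynomial.aeval (diagonal F : MvPowerSeries Unit (ZMod p)) Q = 0 := by
  obtain ⟨W, hFW, hW, hfin, hrank⟩ := MvPowerSeries.exists_cartier_stable_submodule hP0 hP hF
  rw [Fintype.card_fin] at hrank
  let V := W.map (diagonalLinearMap n (ZMod p))
  let b := Module.finBasis (ZMod p) V
  let g : Fin (Module.finrank (ZMod p) V) → PowerSeries (ZMod p) := fun j => b j
  have hspan : Submodule.span (ZMod p) (Set.range g) = V := by
    have := congrArg (Submodule.map V.subtype) b.span_eq
    rwa [Submodule.map_span, ← Set.range_comp, Submodule.map_top, Submodule.range_subtype] at this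
  refine ⟨Module.finrank (ZMod p) V, (Submodule.finrank_map_le _ _).trans hrank,
    exists_annihilator_of_sect_stable (g := g) ?_ ?_⟩
  · rw [hspan]
    rintro r hr _ ⟨w, hw, rfl⟩
    refine ⟨_, hW (Finsupp.equivFunOnFinite.symm fun _ => r) (fun i => by simpa using hr) w hw, ?_⟩
    exact (sect_diagonal p r w).symm
  · rw [hspan]
    exact ⟨F, hFW, rfl⟩

theorem computable_bound :
    Computable fun t : ℕ × ℕ × ℕ => t.2.1 * (t.2.2 + 1) ^ t.1 + 1 := by
  have hpow : Primrec₂ fun a b : ℕ => a ^ b := by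
    refine (Primrec.nat_rec (f := fun _ : ℕ => 1) (g := fun a (q : ℕ × ℕ) => q.2 * a)
      (Primrec.const 1)
      (Primrec.nat_mul.comp (Primrec.snd.comp Primrec.snd) Primrec.fst)).of_eq ?_
    intro a b
    induction b with
    | zero => rfl
    | succ b ih => rw [pow_succ, ← ih]
  refine Primrec.to_comp (Primrec.succ.comp (Primrec.nat_mul.comp
    (Primrec.fst.comp Primrec.snd)
    (hpow.comp (Primrec.succ.comp (Primrec.snd.comp Primrec.snd)) Primrec.fst)))

end AlgSeries

theorem mainTheorem2 :
    ∃ A : ℕ → ℕ → ℕ → ℕ,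
      (Computable fun t : ℕ × ℕ × ℕ => A t.1 t.2.1 t.2.2) ∧
      ∀ (n d h : ℕ) (f : MvPowerSeries (Fin n) ℤ),
        AlgSeries.IsAlgebraicSeries (MvPowerSeries.map (Int.castRingHom ℚ) f) →
        AlgSeries.degree (MvPowerSeries.map (Int.castRingHom ℚ) f) ≤ d →
        AlgSeries.height (MvPowerSeries.map (Int.castRingHom ℚ) f) ≤ h →
        ∀ (p : ℕ) [Fact p.Prime],
          AlgSeries.IsAlgebraicSeries
              (PowerSeries.map (Int.castRingHom (ZMod p)) (AlgSeries.diagonal f)) ∧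
            AlgSeries.degree
              (PowerSeries.map (Int.castRingHom (ZMod p)) (AlgSeries.diagonal f)) ≤
                p ^ A n d h ∧
            AlgSeries.height
              (PowerSeries.map (Int.castRingHom (ZMod p)) (AlgSeries.diagonal f)) ≤
                A n d h ^ 2 * p ^ (A n d h + 1) := by
  -- Only N ≤ A is used: p^N and N p^N then fit within the stated bounds with room to spare.
  refine ⟨fun n d h => d * (h + 1) ^ n + 1, AlgSeries.computable_bound, ?_⟩
  intro n d h f hf hd hh p hp
  have hp0 : 0 < p := hp.out.pos
  obtain ⟨P, hP0, hP, hPf⟩ := AlgSeries.exists_annihilator_mod p hf hd hh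
  obtain ⟨N, hN, Q, hQ, hQd, hQh, hQf⟩ := AlgSeries.exists_annihilator_diagonal hP0 hP hPf
  rw [← AlgSeries.map_diagonal] at hQf
  have hNA : N ≤ d * (h + 1) ^ n + 1 := hN.trans (Nat.le_succ _)
  refine ⟨⟨Q, hQ, hQf⟩, Nat.sInf_le ⟨pow_pos hp0 _, Q, hQ, ?_, hQf⟩,
    le_trans (Nat.sInf_le ⟨Q, hQ, hQf, rfl⟩) (hQh.trans ?_)⟩
  · exact hQd.trans (Nat.pow_le_pow_right hp0 hNA)
  · exact Nat.mul_le_mul (hNA.trans (Nat.le_self_pow two_ne_zero _))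
      (Nat.pow_le_pow_right hp0 (hNA.trans (Nat.le_succ _)))
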